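/- **Theorem 1.1.** Let $n\ge 2$, let $\mathbb C^n$ carry its standard flat Hermitian metric and complex structure $J$, and let $N$ be any Kähler manifold, with metric $\langle\cdot,\cdot\rangle$ and complex structure $J'$ (no curvature assumption is made on $N$). Let $f:\mathbb C^n\to N$ be a harmonic map, i.e. a smooth map with vanishing tension field $\tau(f)=\operatorname{trace}\nabla df=0$. For an orthonormal frame $e_1,\dots,e_n,Je_1,\dots,Je_n$ of $\mathbb C^n$ let $$e(f)=\tfrac12\sum_{i=1}^n\big(|f_*e_i|^2+|f_*Je_i|^2\big)$$ be the energy density and $$e''(f)=\tfrac14\sum_{i=1}^n\big(|f_*e_i|^2+|f_*Je_i|^2-2\langle J'f_*e_i,f_*Je_i\rangle\big)=\tfrac14\sum_{i=1}^n|f_*Je_i-J'f_*e_i|^2$$ the $\bar\partial$-energy density of $f$. Suppose that for some $\alpha>0$ $$e(f)(p)\,e''(f)(p)=O\!\left(\frac1{R^{4n+\alpha}}\right),\qquad R=|p|,$$ that is, there are $C>0$ and $R_0>0$ with $e(f)(p)\,e''(f)(p)\le C\,|p|^{-(4n+\alpha)}$ for all $p\in\mathbb C^n$ with $|p|\ge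 R_0$. Then $f$ is holomorphic, i.e. $f_*J=J'f_*$ on all of $\mathbb C^n$. -/

import Mathlib

open scoped Manifold ContDiff

noncomputable section

/-- The real smooth manifold underlying a complex manifold: it has the same charts. -/
instance isManifold_real_of_complex {E : Type*} [NormedAddCommGroup E] [NormedSpace ℂ E]
    {N : Type*} [TopologicalSpace N] [ChartedSpace E N] [IsManifold 𝓘(ℂ, E) ω N] :
    IsManifold 𝓘(ℝ, E) ∞ N := by
  have h : IsManifold 𝓘(ℂ, E) ∞ N := inferInstance
  refine isManifold_of_contDiffOn 𝓘(ℝ, E) ∞ N fun e e' he he' => ?_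
  have h2 := (contDiffGroupoid ∞ 𝓘(ℂ, E)).compatible he he'
  rw [contDiffGroupoid, mem_groupoid_of_pregroupoid] at h2
  have h3 := h2.1
  simp only [contDiffPregroupoid] at h3
  exact h3.restrict_scalars ℝ

section Target

variable {E : Type*} [NormedAddCommGroup E] [NormedSpace ℂ E]
  {N : Type*} [TopologicalSpace N] [ChartedSpace E N]

/-- The complex structure `J'` of a complex manifold `N` modelled on the complex vector space `E`:
on each (real) tangent space it is multiplication by `i`. (Mathlib reads tangent vectors at `y` in
the preferred chart at `y`; as the changes of charts are holomorphic, `J'` is multiplication by `i`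
in every chart.) -/
def complexStructure (y : N) : TangentSpace 𝓘(ℝ, E) y →L[ℝ] TangentSpace 𝓘(ℝ, E) y :=
  (Complex.I • ContinuousLinearMap.id ℝ E : E →L[ℝ] E)

/-- The expression in the chart `c` of a field `B` of bilinear forms on the tangent spaces of `N`:
its pull-back under `c⁻¹` (the tangent spaces of `N` being copies of `E`), so `coordForm c B x v w = ∑ B_{ij}(x) vⁱ wʲ` for `x ∈ c.target`. -/
def coordForm (c : OpenPartialHomeomorph N E)
    (B : ∀ y : N, TangentSpace 𝓘(ℝ, E) y →L[ℝ] TangentSpace 𝓘(ℝ, E) y →L[ℝ] ℝ) (x : E) :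
    E →L[ℝ] E →L[ℝ] ℝ :=
  let A : E →L[ℝ] E := mfderiv 𝓘(ℝ, E) 𝓘(ℝ, E) c.symm x
  let Bx : E →L[ℝ] E →L[ℝ] ℝ := B (c.symm x)
  Bx.bilinearComp A A

variable (E N) in
/-- A Kähler metric on the complex manifold `N`: a smooth Riemannian metric `g` for which `J'` is
isometric and whose Kähler form `g(J' ·, ·)` is closed. -/
structure KahlerMetric [IsManifold 𝓘(ℂ, E) ω N] extends
    Bundle.ContMDiffRiemannianMetric 𝓘(ℝ, E) ∞ E (fun y : N => TangentSpace 𝓘(ℝ, E) y) where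
  /-- The metric is Hermitian. -/
  inner_complexStructure : ∀ (y : N) (v w : TangentSpace 𝓘(ℝ, E) y),
    inner y (complexStructure y v) (complexStructure y w) = inner y v w
  /-- The exterior derivative of the Kähler form, computed in charts on constant vector fields
  `a`, `b`, `d`, vanishes. -/
  closed : ∀ c ∈ atlas E N, ∀ x ∈ c.target, ∀ a b d : E,
    let D := fderiv ℝ (coordForm c fun y => (inner y).comp (complexStructure y)) x
    D a b d + D b d a + D d a b = 0

variable [IsManifold 𝓘(ℂ, E) ω N]

namespace KahlerMetric

/-- The Christoffel symbol of the first kind of the metric in the chart `c`, as a linear form in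
the lowered slot: `d ↦ ½ (∂_a g(b, d) + ∂_b g(a, d) - ∂_d g(a, b))` at the point `x`. -/
def christoffelFirst (g : KahlerMetric E N) (c : OpenPartialHomeomorph N E) (x a b : E) :
    E →L[ℝ] ℝ :=
  let D := fderiv ℝ (coordForm c g.inner) x
  (1 / 2 : ℝ) • (D a b + D b a - (D.flip a).flip b)

/-- The Christoffel symbol `Γ(a, b)`, with components `Γᵏ_{ij} aⁱ bʲ`, of the Levi-Civita
connection in the chart `c` at the point `x`: the index of `christoffelFirst` is raised with the
inverse of the metric `v ↦ g(v, ·)`. -/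
def christoffel (g : KahlerMetric E N) (c : OpenPartialHomeomorph N E) (x a b : E) : E :=
  (coordForm c g.inner x).inverse (g.christoffelFirst c x a b)

/-- The squared length of a tangent vector. -/
def sqNorm (g : KahlerMetric E N) {y : N} (v : TangentSpace 𝓘(ℝ, E) y) : ℝ := g.inner y v v

end KahlerMetric

variable {n : ℕ}

/-- The differential `f_* v` of a map `f : ℂⁿ → N` at `p` (for the real structures). -/
def pushforward (f : EuclideanSpace ℂ (Fin n) → N) (p v : EuclideanSpace ℂ (Fin n)) :
    TangentSpace 𝓘(ℝ, E) (f p) :=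
  mfderiv 𝓘(ℝ, EuclideanSpace ℂ (Fin n)) 𝓘(ℝ, E) f p v

variable (n) in
/-- The standard orthonormal frame `e₁, …, eₙ, J e₁, …, J eₙ` of `ℂⁿ`. -/
def stdFrame : Fin n ⊕ Fin n → EuclideanSpace ℂ (Fin n)
  | Sum.inl i => EuclideanSpace.single i 1
  | Sum.inr i => Complex.I • EuclideanSpace.single i 1

/-- The tension field `τ(f) = trace ∇df` of a map `f : ℂⁿ → N` at `p`. With `u` the expression of
`f` in the preferred chart at `f p`, it is `∑_k (∂_k ∂_k u + Γ(∂_k u, ∂_k u))`; the frame `stdFrame`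
of `ℂⁿ` is parallel. -/
def tensionField (g : KahlerMetric E N) (f : EuclideanSpace ℂ (Fin n) → N)
    (p : EuclideanSpace ℂ (Fin n)) : TangentSpace 𝓘(ℝ, E) (f p) :=
  let c := chartAt E (f p)
  let u : EuclideanSpace ℂ (Fin n) → E := fun q => c (f q)
  (∑ k, (fderiv ℝ (fun q => fderiv ℝ u q (stdFrame n k)) p (stdFrame n k) +
    g.christoffel c (u p) (fderiv ℝ u p (stdFrame n k)) (fderiv ℝ u p (stdFrame n k))) : E)

/-- A harmonic map `ℂⁿ → N` is a smooth map whose tension field vanishes. -/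
def IsHarmonicMap (g : KahlerMetric E N) (f : EuclideanSpace ℂ (Fin n) → N) : Prop :=
  ContMDiff 𝓘(ℝ, EuclideanSpace ℂ (Fin n)) 𝓘(ℝ, E) ∞ f ∧ ∀ p, tensionField g f p = 0

/-- The energy density `e(f) = ½ ∑ |f_* e_k|²`, over the orthonormal frame of `ℂⁿ`. -/
def energyDensity (g : KahlerMetric E N) (f : EuclideanSpace ℂ (Fin n) → N)
    (p : EuclideanSpace ℂ (Fin n)) : ℝ :=
  (1 / 2) * ∑ k, g.sqNorm (pushforward (E := E) f p (stdFrame n k))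

/-- The `∂̄`-energy density
`e''(f) = ¼ ∑_{i ≤ n} (|f_* e_i|² + |f_* J e_i|² - 2 ⟨J' f_* e_i, f_* J e_i⟩)`, which is
`¼ ∑_{i ≤ n} |f_* J e_i - J' f_* e_i|²`. -/
def dbarEnergyDensity (g : KahlerMetric E N) (f : EuclideanSpace ℂ (Fin n) → N)
    (p : EuclideanSpace ℂ (Fin n)) : ℝ :=
  (1 / 4) * ∑ i : Fin n,
    (g.sqNorm (pushforward (E := E) f p (stdFrame n (Sum.inl i))) +
      g.sqNorm (pushforward (E := E) f p (stdFrame n (Sum.inr i))) -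
      2 * g.inner (f p) (complexStructure (f p) (pushforward f p (stdFrame n (Sum.inl i))))
        (pushforward f p (stdFrame n (Sum.inr i))))

variable (E) in
/-- A map `f : ℂⁿ → N` is holomorphic if it is smooth and `f_* J = J' f_*`. -/
def IsHolomorphicMap (f : EuclideanSpace ℂ (Fin n) → N) : Prop :=
  ContMDiff 𝓘(ℝ, EuclideanSpace ℂ (Fin n)) 𝓘(ℝ, E) ∞ f ∧
    ∀ p v, pushforward (E := E) f p (Complex.I • v) = complexStructure (f p) (pushforward f p v)

end Target

end

open scoped Manifold ContDiff

/-! Let `D = f_* J - J' f_*` and `T(v, w) = ⟨f_* v, J' D w⟩` (`dbarStress`). Since `J` is skew on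
`ℂⁿ` and `D` anticommutes with the complex structures, `2 tr T = ∑ |D e_k|² = 8 e''`
(`sum_form_dbarDefect`). The map is harmonic and `J'` is parallel, so `T` obeys the conservation law
`d(tr T)(v) = 2 ∑ ∂_k T(v, e_k)` (`IsHarmonicMap.fderiv_sum_dbarStress`): `(tr T) Id - 2T` is
divergence free.

Contracting twice this tensor with the position vector gives the field `V_k = 2 x_k tr T - 4 T(x,
e_k)`, with `div V = (2n - 2) · 2 tr T`, a positive multiple of `e''` as `n ≥ 2`. Cauchy–Schwarz
gives `T(e_l, e_k)² ≤ 16 e(f) e''(f)`, so the decay hypothesis makes `V` of size `O(R ^ (1 - 2n -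
α/2))`. Testing the divergence against a cut-off at scale `R` (gradient `O(1/R)`, support of volume
`O(R ^ 2n)`) leaves `O(R ^ (-α/2))`. Hence `∑ |D e_k|² = 0`. -/

noncomputable section

/-! ### Kähler geometry of the target in charts -/

section Chart

variable {E : Type*} [NormedAddCommGroup E] [NormedSpace ℂ E]
  {N : Type*} [TopologicalSpace N] [ChartedSpace E N]

/-- The derivative of the inverse of a chart, the tangent spaces of `N` being copies of `E`. -/
def chartSymmDeriv (c : OpenPartialHomeomorph N E) (x : E) : E →L[ℝ] E :=
  mfderiv 𝓘(ℝ, E) 𝓘(ℝ, E) c.symm x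

variable [IsManifold 𝓘(ℂ, E) ω N]

theorem isManifold_real_one_of_complex : IsManifold 𝓘(ℝ, E) 1 N :=
  IsManifold.of_le (n := ∞) (by norm_cast)

theorem mdifferentiable_of_mem_atlas_complex {c : OpenPartialHomeomorph N E}
    (hc : c ∈ atlas E N) : c.MDifferentiable 𝓘(ℝ, E) 𝓘(ℝ, E) :=
  have : IsManifold 𝓘(ℝ, E) 1 N := isManifold_real_one_of_complex
  mdifferentiable_of_mem_atlas hc

/-- Charts are holomorphic, so the real derivative is the complex one with scalars restricted. It
makes `J'` the constant operator `i` in every chart. -/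
theorem chartSymmDeriv_I_smul {c : OpenPartialHomeomorph N E} (hc : c ∈ atlas E N) {x : E}
    (hx : x ∈ c.target) (v : E) :
    chartSymmDeriv c x (Complex.I • v) = Complex.I • chartSymmDeriv c x v := by
  have : IsManifold 𝓘(ℂ, E) 1 N := IsManifold.of_le (n := ω) le_top
  have h : MDifferentiableAt 𝓘(ℂ, E) 𝓘(ℂ, E) c.symm x :=
    (mdifferentiable_of_mem_atlas (I := 𝓘(ℂ, E)) hc).mdifferentiableAt_symm hx
  have h1 := h.hasMFDerivAt
  let A : E →L[ℂ] E := mfderiv 𝓘(ℂ, E) 𝓘(ℂ, E) c.symm x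
  have h2 : HasMFDerivAt 𝓘(ℝ, E) 𝓘(ℝ, E) c.symm x (A.restrictScalars ℝ) :=
    ⟨h1.1, HasFDerivWithinAt.restrictScalars ℝ h1.2⟩
  have h3 : chartSymmDeriv c x = A.restrictScalars ℝ := h2.mfderiv
  rw [h3]
  exact A.map_smul Complex.I v

theorem chartSymmDeriv_injective {c : OpenPartialHomeomorph N E} (hc : c ∈ atlas E N) {x : E}
    (hx : x ∈ c.target) : Function.Injective (chartSymmDeriv c x) :=
  (mdifferentiable_of_mem_atlas_complex (E := E) hc).symm.mfderiv_injective (x := x) hx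

theorem contMDiffAt_chart_symm {c : OpenPartialHomeomorph N E} (hc : c ∈ atlas E N) {x : E}
    (hx : x ∈ c.target) : ContMDiffAt 𝓘(ℝ, E) 𝓘(ℝ, E) ∞ c.symm x :=
  (contMDiffOn_symm_of_mem_maximalAtlas (IsManifold.subset_maximalAtlas hc)).contMDiffAt
    (c.open_target.mem_nhds hx)

theorem contMDiffAt_mfderiv_chart_symm {c : OpenPartialHomeomorph N E} (hc : c ∈ atlas E N) {x : E}
    (hx : x ∈ c.target) (v : E) :
    ContMDiffAt 𝓘(ℝ, E) (𝓘(ℝ, E).prod 𝓘(ℝ, E)) ∞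
      (fun m => (⟨c.symm m, mfderiv 𝓘(ℝ, E) 𝓘(ℝ, E) c.symm m v⟩ :
        Bundle.TotalSpace E (fun y : N => TangentSpace 𝓘(ℝ, E) y))) x := by
  have : IsManifold 𝓘(ℝ, E) 1 N := isManifold_real_one_of_complex
  have h1 : ContMDiffOn 𝓘(ℝ, E) 𝓘(ℝ, E) ∞ c.symm c.target :=
    contMDiffOn_symm_of_mem_maximalAtlas (IsManifold.subset_maximalAtlas hc)
  have h2 := h1.contMDiffOn_tangentMapWithin (m := ∞) le_rfl c.open_target.uniqueMDiffOn
  have h3 : ContMDiff 𝓘(ℝ, E) (𝓘(ℝ, E).prod 𝓘(ℝ, E)) ∞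
      (fun m => (⟨m, v⟩ : TangentBundle 𝓘(ℝ, E) E)) := by
    intro m
    rw [Bundle.contMDiffAt_totalSpace]
    refine ⟨contMDiffAt_id, ?_⟩
    simp
    exact contMDiffAt_const
  have h4 := h2.comp (s := c.target) h3.contMDiffOn (fun m hm => hm)
  refine ((h4.contMDiffAt (c.open_target.mem_nhds hx))).congr_of_eventuallyEq ?_
  filter_upwards [c.open_target.mem_nhds hx] with m hm
  simp only [Function.comp, tangentMapWithin]
  rw [mfderivWithin_of_isOpen c.open_target hm]

namespace KahlerMetric

/-- The metric as a field of bilinear forms on `E`, the tangent spaces of `N` being copies of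
`E`. -/
def form (g : KahlerMetric E N) (y : N) : E →L[ℝ] E →L[ℝ] ℝ := g.inner y

variable (g : KahlerMetric E N) {c : OpenPartialHomeomorph N E} {x : E}

theorem form_symm (y : N) (v w : E) : g.form y v w = g.form y w v := g.symm y v w

theorem form_I_smul (y : N) (v w : E) :
    g.form y (Complex.I • v) (Complex.I • w) = g.form y v w :=
  g.inner_complexStructure y v w

theorem form_self_pos (y : N) {v : E} (hv : v ≠ 0) : 0 < g.form y v v := g.pos y v hv

theorem form_self_nonneg (y : N) (v : E) : 0 ≤ g.form y v v := by
  by_cases h : v = 0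
  · simp [h]
  · exact (g.form_self_pos y h).le

theorem form_I_smul_left (y : N) (v w : E) :
    g.form y (Complex.I • v) w = - g.form y v (Complex.I • w) := by
  rw [← g.form_I_smul y v, smul_smul, Complex.I_mul_I]
  simp

theorem coordForm_eq (v w : E) :
    coordForm c g.inner x v w =
      g.form (c.symm x) (chartSymmDeriv c x v) (chartSymmDeriv c x w) := rfl

theorem coordForm_symm (v w : E) :
    coordForm c g.inner x v w = coordForm c g.inner x w v := by
  rw [coordForm_eq, coordForm_eq, form_symm]

theorem coordForm_I_smul_left (hc : c ∈ atlas E N) (hx : x ∈ c.target) (v w : E) :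
    coordForm c g.inner x (Complex.I • v) w = - coordForm c g.inner x v (Complex.I • w) := by
  rw [coordForm_eq, coordForm_eq, chartSymmDeriv_I_smul hc hx, chartSymmDeriv_I_smul hc hx,
    form_I_smul_left]

theorem coordForm_kahlerForm (hc : c ∈ atlas E N) (hx : x ∈ c.target) (v w : E) :
    coordForm c (fun y => (g.inner y).comp (complexStructure y)) x v w =
      coordForm c g.inner x (Complex.I • v) w := by
  rw [coordForm_eq, chartSymmDeriv_I_smul hc hx]
  rfl

variable [FiniteDimensional ℂ E]

theorem contDiffAt_coordForm (hc : c ∈ atlas E N) (hx : x ∈ c.target) :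
    ContDiffAt ℝ ∞ (coordForm c g.inner) x := by
  have : FiniteDimensional ℝ E := FiniteDimensional.complexToReal E
  suffices h : ContDiffOn ℝ ∞ (coordForm c g.inner) c.target from
    h.contDiffAt (c.open_target.mem_nhds hx)
  rw [contDiffOn_clm_apply]
  intro v
  rw [contDiffOn_clm_apply]
  intro w y hy
  refine ContDiffAt.contDiffWithinAt ?_
  rw [← contMDiffAt_iff_contDiffAt]
  have : ContMDiffAt 𝓘(ℝ, E) (𝓘(ℝ, E).prod 𝓘(ℝ)) ∞
      (fun m ↦ Bundle.TotalSpace.mk' ℝ (E := Bundle.Trivial N ℝ) (c.symm m)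
        (g.inner (c.symm m) (mfderiv 𝓘(ℝ, E) 𝓘(ℝ, E) c.symm m v)
          (mfderiv 𝓘(ℝ, E) 𝓘(ℝ, E) c.symm m w))) y := by
    apply ContMDiffAt.clm_bundle_apply₂ (F₁ := E) (F₂ := E)
    · exact ContMDiffAt.comp y g.contMDiff.contMDiffAt (contMDiffAt_chart_symm hc hy)
    · exact contMDiffAt_mfderiv_chart_symm hc hy v
    · exact contMDiffAt_mfderiv_chart_symm hc hy w
  simp only [Bundle.contMDiffAt_totalSpace] at this
  exact this.2

/-- Positivity gives injectivity and equality of dimensions does the rest. Thus `inverse` in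
`christoffel` is a true inverse and not its default value `0`. -/
theorem isInvertible_coordForm (hc : c ∈ atlas E N) (hx : x ∈ c.target) :
    (coordForm c g.inner x).IsInvertible := by
  have : FiniteDimensional ℝ E := FiniteDimensional.complexToReal E
  have hinj : Function.Injective (coordForm c g.inner x : E →ₗ[ℝ] E →L[ℝ] ℝ) := by
    rw [← LinearMap.ker_eq_bot, LinearMap.ker_eq_bot']
    intro v hv
    by_contra h
    have h0 : coordForm c g.inner x v = 0 := hv
    have h1 : chartSymmDeriv c x v ≠ 0 := fun h2 =>
      h (chartSymmDeriv_injective hc hx (h2.trans (map_zero _).symm))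
    have h2 := g.form_self_pos (c.symm x) h1
    rw [← coordForm_eq, h0] at h2
    exact lt_irrefl _ h2
  have hrank : Module.finrank ℝ E = Module.finrank ℝ (E →L[ℝ] ℝ) := by
    rw [← (LinearMap.toContinuousLinearMap (𝕜 := ℝ) (E := E) (F' := ℝ)).finrank_eq]
    exact (Subspace.dual_finrank_eq (K := ℝ) (V := E)).symm
  let e := LinearEquiv.ofInjectiveOfFinrankEq (coordForm c g.inner x : E →ₗ[ℝ] E →L[ℝ] ℝ) hinj hrank
  exact ⟨e.toContinuousLinearEquiv, by ext; rfl⟩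

theorem coordForm_christoffel (hc : c ∈ atlas E N) (hx : x ∈ c.target) (a b d : E) :
    coordForm c g.inner x (g.christoffel c x a b) d = (1 / 2) *
      (fderiv ℝ (coordForm c g.inner) x a b d + fderiv ℝ (coordForm c g.inner) x b a d -
        fderiv ℝ (coordForm c g.inner) x d a b) := by
  rw [christoffel, (g.isInvertible_coordForm hc hx).self_apply_inverse]
  simp [christoffelFirst]

theorem hasFDerivAt_coordForm_apply (hc : c ∈ atlas E N) (hx : x ∈ c.target) (a b : E) :
    HasFDerivAt (fun y => coordForm c g.inner y a b)
      (((fderiv ℝ (coordForm c g.inner) x).flip a).flip b) x := by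
  have h := ((g.contDiffAt_coordForm hc hx).differentiableAt (by simp)).hasFDerivAt
  have h2 := (h.clm_apply (hasFDerivAt_const a x)).clm_apply (hasFDerivAt_const b x)
  exact h2.congr_fderiv (by ext v; simp)

theorem fderiv_coordForm_symm (hc : c ∈ atlas E N) (hx : x ∈ c.target) (v a b : E) :
    fderiv ℝ (coordForm c g.inner) x v a b = fderiv ℝ (coordForm c g.inner) x v b a := by
  have h1 := g.hasFDerivAt_coordForm_apply hc hx a b
  have h2 := g.hasFDerivAt_coordForm_apply hc hx b a
  have h3 : (fun y => coordForm c g.inner y a b) = fun y => coordForm c g.inner y b a :=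
    funext fun y => g.coordForm_symm a b
  rw [h3] at h1
  exact congrArg (fun L : E →L[ℝ] ℝ => L v) (h1.unique h2)

/-- `i` is constant in the chart, so the Hermitian identity may be differentiated on the open set
`c.target`. -/
theorem fderiv_coordForm_I_smul_left (hc : c ∈ atlas E N) (hx : x ∈ c.target) (v a b : E) :
    fderiv ℝ (coordForm c g.inner) x v (Complex.I • a) b =
      - fderiv ℝ (coordForm c g.inner) x v a (Complex.I • b) := by
  have h1 := g.hasFDerivAt_coordForm_apply hc hx (Complex.I • a) b
  have h2 := (g.hasFDerivAt_coordForm_apply hc hx a (Complex.I • b)).neg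
  have h3 : (fun y => coordForm c g.inner y (Complex.I • a) b) =ᶠ[nhds x]
      - fun y => coordForm c g.inner y a (Complex.I • b) := by
    filter_upwards [c.open_target.mem_nhds hx] with y hy using g.coordForm_I_smul_left hc hy a b
  exact congrArg (fun L : E →L[ℝ] ℝ => L v) (h1.unique (h2.congr_of_eventuallyEq h3))

theorem fderiv_coordForm_closed (hc : c ∈ atlas E N) (hx : x ∈ c.target) (a b d : E) :
    fderiv ℝ (coordForm c g.inner) x a (Complex.I • b) d +
      fderiv ℝ (coordForm c g.inner) x b (Complex.I • d) a +
      fderiv ℝ (coordForm c g.inner) x d (Complex.I • a) b = 0 := by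
  obtain ⟨J, hJ⟩ : ∃ J : E →L[ℝ] E, ∀ v, J v = Complex.I • v :=
    ⟨Complex.I • ContinuousLinearMap.id ℝ E, fun v => rfl⟩
  have h := ((g.contDiffAt_coordForm hc hx).differentiableAt (by simp)).hasFDerivAt
  have h2 := h.clm_comp (hasFDerivAt_const J x)
  have h3 : (coordForm c fun y => (g.inner y).comp (complexStructure y)) =ᶠ[nhds x]
      fun y => (coordForm c g.inner y).comp J := by
    filter_upwards [c.open_target.mem_nhds hx] with y hy
    ext v w
    rw [g.coordForm_kahlerForm hc hy, ContinuousLinearMap.comp_apply, hJ]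
  have h4 := g.closed c hc x hx a b d
  rw [(h2.congr_of_eventuallyEq h3).fderiv] at h4
  simpa [hJ] using h4

/-- The Levi-Civita connection is metric. -/
theorem fderiv_coordForm (hc : c ∈ atlas E N) (hx : x ∈ c.target) (v a b : E) :
    fderiv ℝ (coordForm c g.inner) x v a b =
      coordForm c g.inner x (g.christoffel c x v a) b +
        coordForm c g.inner x a (g.christoffel c x v b) := by
  rw [g.coordForm_symm a, g.coordForm_christoffel hc hx, g.coordForm_christoffel hc hx]
  linarith [g.fderiv_coordForm_symm hc hx v b a, g.fderiv_coordForm_symm hc hx a b v,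
    g.fderiv_coordForm_symm hc hx b a v]

theorem christoffel_symm (hc : c ∈ atlas E N) (hx : x ∈ c.target) (a b : E) :
    g.christoffel c x a b = g.christoffel c x b a := by
  apply (g.isInvertible_coordForm hc hx).injective
  ext d
  rw [g.coordForm_christoffel hc hx, g.coordForm_christoffel hc hx,
    g.fderiv_coordForm_symm hc hx d a b]
  ring

/-- The complex structure of a Kähler manifold is parallel. -/
theorem christoffel_I_smul (hc : c ∈ atlas E N) (hx : x ∈ c.target) (a b : E) :
    g.christoffel c x a (Complex.I • b) = Complex.I • g.christoffel c x a b := by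
  apply (g.isInvertible_coordForm hc hx).injective
  ext d
  rw [g.coordForm_I_smul_left hc hx, g.coordForm_christoffel hc hx, g.coordForm_christoffel hc hx]
  have hI : ∀ v : E, Complex.I • Complex.I • v = -v := fun v => by
    rw [smul_smul, Complex.I_mul_I, neg_one_smul]
  -- The claim is the difference of the closedness identities at `(a, b, d)` and `(a, ib, id)`,
  -- simplified by the symmetry and `J'`-invariance of the differentiated metric.
  have c1 := g.fderiv_coordForm_closed hc hx a b d
  have c2 := g.fderiv_coordForm_closed hc hx a (Complex.I • b) (Complex.I • d)
  rw [hI, hI] at c2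
  have hJ := g.fderiv_coordForm_I_smul_left hc hx
  have hS := g.fderiv_coordForm_symm hc hx
  have e1 := hJ a b d
  have e2 := hJ d a b
  have e3 := hS b (Complex.I • d) a
  have e4 := hJ (Complex.I • d) a (Complex.I • b)
  have e5 := hS (Complex.I • b) d a
  rw [hI] at e4
  simp only [map_neg, neg_apply] at *
  linarith

end KahlerMetric

end Chart

/-! ### Second fundamental form of a harmonic map -/

section Hessian

variable {E : Type*} [NormedAddCommGroup E] [NormedSpace ℂ E]
  {N : Type*} [TopologicalSpace N] [ChartedSpace E N] {n : ℕ}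

/-- The differential of `f`, the tangent spaces of `N` being copies of `E`. -/
def pushforwardCLM (f : EuclideanSpace ℂ (Fin n) → N) (p : EuclideanSpace ℂ (Fin n)) :
    EuclideanSpace ℂ (Fin n) →L[ℝ] E :=
  mfderiv 𝓘(ℝ, EuclideanSpace ℂ (Fin n)) 𝓘(ℝ, E) f p

variable [IsManifold 𝓘(ℂ, E) ω N]

theorem contDiffAt_chart_comp {f : EuclideanSpace ℂ (Fin n) → N}
    (hf : ContMDiff 𝓘(ℝ, EuclideanSpace ℂ (Fin n)) 𝓘(ℝ, E) ∞ f)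
    {c : OpenPartialHomeomorph N E} (hc : c ∈ atlas E N) {p : EuclideanSpace ℂ (Fin n)}
    (hp : f p ∈ c.source) : ContDiffAt ℝ ∞ (fun q => c (f q)) p := by
  rw [← contMDiffAt_iff_contDiffAt]
  exact ((contMDiffOn_of_mem_maximalAtlas (I := 𝓘(ℝ, E))
    (IsManifold.subset_maximalAtlas hc)).contMDiffAt (c.open_source.mem_nhds hp)).comp p
    hf.contMDiffAt

theorem pushforwardCLM_eq {f : EuclideanSpace ℂ (Fin n) → N}
    (hf : ContMDiff 𝓘(ℝ, EuclideanSpace ℂ (Fin n)) 𝓘(ℝ, E) ∞ f)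
    {c : OpenPartialHomeomorph N E} (hc : c ∈ atlas E N) {p : EuclideanSpace ℂ (Fin n)}
    (hp : f p ∈ c.source) (v : EuclideanSpace ℂ (Fin n)) :
    pushforwardCLM (E := E) f p v =
      chartSymmDeriv c (c (f p)) (fderiv ℝ (fun q => c (f q)) p v) := by
  have hu := (contDiffAt_chart_comp hf hc hp).differentiableAt (by simp)
  have h1 : HasMFDerivAt 𝓘(ℝ, EuclideanSpace ℂ (Fin n)) 𝓘(ℝ, E) (fun q => c (f q)) p
      (fderiv ℝ (fun q => c (f q)) p) := hu.hasFDerivAt.hasMFDerivAt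
  have h2 := ((contMDiffAt_chart_symm hc (c.map_source hp)).mdifferentiableAt
    (by simp)).hasMFDerivAt
  have h3 := HasMFDerivAt.comp p h2 h1
  have h4 : f =ᶠ[nhds p] c.symm ∘ fun q => c (f q) := by
    filter_upwards [hf.continuous.continuousAt.preimage_mem_nhds (c.open_source.mem_nhds hp)]
      with q hq using (c.left_inv hq).symm
  have h5 := h3.congr_of_eventuallyEq h4
  have h6 : pushforwardCLM (E := E) f p =
    (chartSymmDeriv c (c (f p))).comp (fderiv ℝ (fun q => c (f q)) p) := h5.mfderiv
  rw [h6]; rfl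

variable {g : KahlerMetric E N} {f : EuclideanSpace ℂ (Fin n) → N}

/-- Derivatives at `p` must be computed in one chart, fixed while `q` moves. The scalar `z` treats
the metric (`z = 1`) and the Kähler form (`z = i`) together. -/
theorem eventually_form_pushforwardCLM
    (hf : ContMDiff 𝓘(ℝ, EuclideanSpace ℂ (Fin n)) 𝓘(ℝ, E) ∞ f)
    (p v w : EuclideanSpace ℂ (Fin n)) {z : ℂ} (hz : z = 1 ∨ z = Complex.I) :
    (fun q => g.form (f q) (z • pushforwardCLM f q v) (pushforwardCLM f q w)) =ᶠ[nhds p]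
      fun q => coordForm (chartAt E (f p)) g.inner (chartAt E (f p) (f q))
        (z • fderiv ℝ (fun q => chartAt E (f p) (f q)) q v)
        (fderiv ℝ (fun q => chartAt E (f p) (f q)) q w) := by
  have hc : chartAt E (f p) ∈ atlas E N := chart_mem_atlas E (f p)
  filter_upwards [hf.continuous.continuousAt.preimage_mem_nhds
    ((chartAt E (f p)).open_source.mem_nhds (mem_chart_source E (f p)))] with q hq
  have hz2 : ∀ x, chartSymmDeriv (chartAt E (f p)) (chartAt E (f p) (f q)) (z • x) =
      z • chartSymmDeriv (chartAt E (f p)) (chartAt E (f p) (f q)) x := by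
    rcases hz with rfl | rfl
    · simp
    · exact chartSymmDeriv_I_smul hc ((chartAt E (f p)).map_source hq)
  rw [pushforwardCLM_eq hf hc hq, pushforwardCLM_eq hf hc hq, KahlerMetric.coordForm_eq, hz2,
    (chartAt E (f p)).left_inv hq]

variable [FiniteDimensional ℂ E]

/-- The chain rule turns metric compatibility of the Levi-Civita connection into that of the
connection pulled back along `u`. -/
theorem KahlerMetric.fderiv_coordForm_comp (g : KahlerMetric E N) {c : OpenPartialHomeomorph N E}
    (hc : c ∈ atlas E N) {W : Type*} [NormedAddCommGroup W] [NormedSpace ℝ W]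
    {u a b : W → E} {u' a' b' : W →L[ℝ] E} {p : W} (hp : u p ∈ c.target)
    (hu : HasFDerivAt u u' p) (ha : HasFDerivAt a a' p) (hb : HasFDerivAt b b' p) (v : W) :
    fderiv ℝ (fun q => coordForm c g.inner (u q) (a q) (b q)) p v =
      coordForm c g.inner (u p) (a' v + g.christoffel c (u p) (u' v) (a p)) (b p) +
      coordForm c g.inner (u p) (a p) (b' v + g.christoffel c (u p) (u' v) (b p)) := by
  have h := ((g.contDiffAt_coordForm hc hp).differentiableAt (by simp)).hasFDerivAt
  have h2 := ((h.comp p hu).clm_apply ha).clm_apply hb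
  simp only [Function.comp_def] at h2
  rw [h2.fderiv]
  have h3 := g.fderiv_coordForm hc hp (u' v) (a p) (b p)
  simp [h3]
  ring

theorem contDiff_form_pushforwardCLM
    (hf : ContMDiff 𝓘(ℝ, EuclideanSpace ℂ (Fin n)) 𝓘(ℝ, E) ∞ f)
    (v w : EuclideanSpace ℂ (Fin n)) {z : ℂ} (hz : z = 1 ∨ z = Complex.I) :
    ContDiff ℝ ∞
      (fun q => g.form (f q) (z • pushforwardCLM f q v) (pushforwardCLM f q w)) := by
  rw [contDiff_iff_contDiffAt]
  intro p
  refine ContDiffAt.congr_of_eventuallyEq ?_ (eventually_form_pushforwardCLM hf p v w hz)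
  have hc : chartAt E (f p) ∈ atlas E N := chart_mem_atlas E (f p)
  have hu := contDiffAt_chart_comp hf hc (mem_chart_source E (f p))
  have hdu : ∀ v, ContDiffAt ℝ ∞ (fun q => fderiv ℝ (fun q => chartAt E (f p) (f q)) q v) p :=
    fun v => (hu.fderiv_right (m := ∞) le_rfl).clm_apply contDiffAt_const
  exact ((((g.contDiffAt_coordForm hc (mem_chart_target E (f p))).comp p hu).clm_apply
    ((hdu v).const_smul z)).clm_apply (hdu w))

/-- The second fundamental form `B = ∇ df` of a harmonic map at a point, with the derivative it
gives for the inner products `⟨df v, df w⟩` and `⟨J' df v, df w⟩`. -/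
theorem IsHarmonicMap.exists_hessian (hf : IsHarmonicMap g f) (p : EuclideanSpace ℂ (Fin n)) :
    ∃ B : EuclideanSpace ℂ (Fin n) → EuclideanSpace ℂ (Fin n) → E,
      (∀ v w, B v w = B w v) ∧ (∀ v w, B v (-w) = -B v w) ∧
      ∑ k, B (stdFrame n k) (stdFrame n k) = 0 ∧
      ∀ z : ℂ, z = 1 ∨ z = Complex.I → ∀ a v w,
        fderiv ℝ (fun q => g.form (f q) (z • pushforwardCLM f q v) (pushforwardCLM f q w)) p a =
          g.form (f p) (z • B a v) (pushforwardCLM f p w) +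
            g.form (f p) (z • pushforwardCLM f p v) (B a w) := by
  have hc : chartAt E (f p) ∈ atlas E N := chart_mem_atlas E (f p)
  have hcp := mem_chart_target E (f p)
  have hu := contDiffAt_chart_comp hf.1 hc (mem_chart_source E (f p))
  have hH := hf.2 p
  have hsymm : IsSymmSndFDerivAt ℝ (fun q => chartAt E (f p) (f q)) p :=
    hu.isSymmSndFDerivAt (by simp; exact ENat.LEInfty.out)
  have heq := fun v w z hz => eventually_form_pushforwardCLM (g := g) hf.1 p v w (z := z) hz
  have hpush := pushforwardCLM_eq hf.1 hc (mem_chart_source E (f p))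
  simp only [tensionField] at hH
  set c := chartAt E (f p) with hcdef
  set u : EuclideanSpace ℂ (Fin n) → E := fun q => c (f q) with hudef
  have hup : u p = c (f p) := rfl
  rw [← hup] at hcp
  have hI := fun v => chartSymmDeriv_I_smul hc hcp v
  have hdu : ∀ v, HasFDerivAt (fun q => fderiv ℝ u q v) ((fderiv ℝ (fderiv ℝ u) p).flip v) p := by
    intro v
    have h := ((hu.fderiv_right (m := ∞) le_rfl).differentiableAt (by simp)).hasFDerivAt
    exact (h.clm_apply (hasFDerivAt_const v p)).congr_fderiv (by ext; simp)
  have hfp : c.symm (u p) = f p := c.left_inv (mem_chart_source E (f p))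
  -- `B` is the coordinate Hessian `D²u + Γ(du, du)`, carried back to the tangent space of `N`.
  refine ⟨fun v w => chartSymmDeriv c (u p) (fderiv ℝ (fderiv ℝ u) p v w +
    g.christoffel c (u p) (fderiv ℝ u p v) (fderiv ℝ u p w)), ?_, ?_, ?_, ?_⟩
  · intro v w
    beta_reduce
    rw [hsymm.eq, g.christoffel_symm hc hcp]
  · intro v w
    -- `christoffel` is not bundled as a linear map; writing `-b = i(ib)` lets its `i`-linearity
    -- supply the sign.
    have hneg : ∀ a b, g.christoffel c (u p) a (-b) = - g.christoffel c (u p) a b := by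
      intro a b
      rw [← neg_one_smul ℂ b, ← Complex.I_mul_I, mul_smul, g.christoffel_I_smul hc hcp,
        g.christoffel_I_smul hc hcp, ← mul_smul, Complex.I_mul_I, neg_one_smul]
    beta_reduce
    rw [(fderiv ℝ (fderiv ℝ u) p v).map_neg, (fderiv ℝ u p).map_neg, hneg, ← neg_add, map_neg]
  · rw [← map_sum, ← map_zero (chartSymmDeriv c (u p))]
    congr 1
    refine Eq.trans (Finset.sum_congr rfl fun k _ => ?_) hH
    rw [(hdu _).fderiv]; rfl
  · intro z hz a v w
    have hz2 : ∀ x, chartSymmDeriv c (u p) (z • x) = z • chartSymmDeriv c (u p) x := by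
      rcases hz with rfl | rfl
      · simp
      · exact hI
    have hz3 : ∀ a b, g.christoffel c (u p) a (z • b) = z • g.christoffel c (u p) a b := by
      rcases hz with rfl | rfl
      · simp
      · exact g.christoffel_I_smul hc hcp
    rw [(heq v w z hz).fderiv_eq]
    refine (g.fderiv_coordForm_comp hc hcp (hu.differentiableAt (by simp)).hasFDerivAt
      ((hdu v).const_smul z) (hdu w) a).trans ?_
    simp only [g.coordForm_eq, hfp, hpush, hz2, hz3, ← hup, smul_apply, Pi.smul_apply,
      ContinuousLinearMap.flip_apply, ← smul_add]

end Hessian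

/-! ### The orthonormal frame of `ℂⁿ` and its coordinates -/

section Frame

variable {n : ℕ}

/-- `J` permutes the frame up to sign and is skew, so under a trace it passes to the other slot with
a minus sign. -/
theorem sum_stdFrame_I_smul_left {M : Type*} [AddCommGroup M]
    (h : EuclideanSpace ℂ (Fin n) → EuclideanSpace ℂ (Fin n) → M)
    (h1 : ∀ a b, h (-a) b = -h a b) (h2 : ∀ a b, h a (-b) = -h a b) :
    ∑ k, h (Complex.I • stdFrame n k) (stdFrame n k) =
      -∑ k, h (stdFrame n k) (Complex.I • stdFrame n k) := by
  have hI : ∀ v : EuclideanSpace ℂ (Fin n), Complex.I • Complex.I • v = -v := fun v => by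
    rw [smul_smul, Complex.I_mul_I, neg_one_smul]
  simp only [Fintype.sum_sum_type, stdFrame, hI, h1, h2, Finset.sum_neg_distrib]
  abel

/-- The real coordinates of `ℂⁿ` with respect to `stdFrame`. -/
def stdCoord (n : ℕ) : Fin n ⊕ Fin n → EuclideanSpace ℂ (Fin n) →L[ℝ] ℝ
  | Sum.inl i => Complex.reCLM.comp ((EuclideanSpace.proj i).restrictScalars ℝ)
  | Sum.inr i => Complex.imCLM.comp ((EuclideanSpace.proj i).restrictScalars ℝ)

theorem stdCoord_stdFrame (k l : Fin n ⊕ Fin n) :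
    stdCoord n k (stdFrame n l) = if k = l then 1 else 0 := by
  rcases k with i | i <;> rcases l with j | j <;> simp [stdCoord, stdFrame] <;>
    split_ifs <;> simp

theorem abs_stdCoord_le (k : Fin n ⊕ Fin n) (p : EuclideanSpace ℂ (Fin n)) :
    |stdCoord n k p| ≤ ‖p‖ := by
  rcases k with i | i
  · exact (Complex.abs_re_le_norm _).trans (PiLp.norm_apply_le p i)
  · exact (Complex.abs_im_le_norm _).trans (PiLp.norm_apply_le p i)

theorem sum_stdCoord_smul_stdFrame (p : EuclideanSpace ℂ (Fin n)) :
    ∑ k, stdCoord n k p • stdFrame n k = p := by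
  ext j
  simp [Fintype.sum_sum_type, stdCoord, stdFrame, Pi.single_apply, Complex.re_add_im]

end Frame

/-! ### The conserved tensor of the `∂̄`-energy -/

section Stress

variable {E : Type*} [NormedAddCommGroup E] [NormedSpace ℂ E]
  {N : Type*} [TopologicalSpace N] [ChartedSpace E N] {n : ℕ}

variable (E) in
/-- The failure `f_* J - J' f_*` of `f` to be holomorphic. -/
def dbarDefect (f : EuclideanSpace ℂ (Fin n) → N) (p v : EuclideanSpace ℂ (Fin n)) : E :=
  pushforwardCLM f p (Complex.I • v) - Complex.I • pushforwardCLM f p v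

theorem dbarDefect_I_smul (f : EuclideanSpace ℂ (Fin n) → N) (p v : EuclideanSpace ℂ (Fin n)) :
    dbarDefect E f p (Complex.I • v) = - Complex.I • dbarDefect E f p v := by
  simp only [dbarDefect, smul_sub, smul_smul, neg_mul, Complex.I_mul_I, neg_smul, one_smul, map_neg]
  abel

theorem isHolomorphicMap_of_dbarDefect {f : EuclideanSpace ℂ (Fin n) → N}
    (hf : ContMDiff 𝓘(ℝ, EuclideanSpace ℂ (Fin n)) 𝓘(ℝ, E) ∞ f)
    (h : ∀ p k, dbarDefect E f p (stdFrame n k) = 0) : IsHolomorphicMap E f := by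
  refine ⟨hf, fun p v => ?_⟩
  suffices h2 : dbarDefect E f p v = 0 from sub_eq_zero.1 h2
  rw [← sum_stdCoord_smul_stdFrame v, dbarDefect, Finset.smul_sum, map_sum, map_sum,
    Finset.smul_sum, ← Finset.sum_sub_distrib]
  refine Finset.sum_eq_zero fun k _ => ?_
  rw [smul_comm, ContinuousLinearMap.map_smul, ContinuousLinearMap.map_smul,
    smul_comm Complex.I, ← smul_sub]
  exact smul_eq_zero_of_right _ (h p k)

variable [IsManifold 𝓘(ℂ, E) ω N] (g : KahlerMetric E N) (f : EuclideanSpace ℂ (Fin n) → N)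

/-- The bilinear form `⟨f_* v, J' (f_* J - J' f_*) w⟩`, whose divergence in `w` is the differential
of a multiple of the `∂̄`-energy density. -/
def dbarStress (v w p : EuclideanSpace ℂ (Fin n)) : ℝ :=
  g.form (f p) ((1 : ℂ) • pushforwardCLM f p v) (pushforwardCLM f p w) -
    g.form (f p) (Complex.I • pushforwardCLM f p v) (pushforwardCLM f p (Complex.I • w))

theorem dbarStress_eq (v w p : EuclideanSpace ℂ (Fin n)) :
    dbarStress g f v w p =
      g.form (f p) (pushforwardCLM f p v) (Complex.I • dbarDefect E f p w) := by
  rw [dbarStress, dbarDefect, smul_sub, smul_smul, Complex.I_mul_I, neg_one_smul, map_sub, map_neg,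
    g.form_I_smul_left, one_smul]
  ring

theorem KahlerMetric.form_sq_le (y : N) (v w : E) :
    g.form y v w ^ 2 ≤ g.form y v v * g.form y w w := by
  let B : LinearMap.BilinForm ℝ E := LinearMap.mk₂ ℝ (fun a b => g.form y a b) (by simp) (by simp)
    (by simp) (by simp)
  exact B.apply_sq_le_of_symm (g.form_self_nonneg y) ⟨fun a b => g.form_symm y a b⟩ v w

/-- Expanding one factor of `|D v|²` gives two terms. Skewness of `J` and `D J = -J' D` give them
the same trace, that of `T`. -/
theorem sum_form_dbarDefect (p : EuclideanSpace ℂ (Fin n)) :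
    ∑ k, g.form (f p) (dbarDefect E f p (stdFrame n k)) (dbarDefect E f p (stdFrame n k)) =
      2 * ∑ k, dbarStress g f (stdFrame n k) (stdFrame n k) p := by
  have h := sum_stdFrame_I_smul_left (n := n)
    (fun a b => g.form (f p) (pushforwardCLM f p a) (dbarDefect E f p b))
    (by simp) (fun a b => by simp [dbarDefect]; ring)
  have h2 : ∀ v, g.form (f p) (dbarDefect E f p v) (dbarDefect E f p v) =
      g.form (f p) (pushforwardCLM f p (Complex.I • v)) (dbarDefect E f p v) +
        g.form (f p) (pushforwardCLM f p v) (Complex.I • dbarDefect E f p v) := by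
    intro v
    nth_rw 1 [dbarDefect]
    rw [map_sub, sub_apply, g.form_I_smul_left]
    ring
  simp only [h2, dbarStress_eq, Finset.sum_add_distrib, h, dbarDefect_I_smul, neg_smul, map_neg,
    Finset.sum_neg_distrib]
  ring

theorem energyDensity_eq (p : EuclideanSpace ℂ (Fin n)) :
    energyDensity g f p = (1 / 2) * ∑ k,
      g.form (f p) (pushforwardCLM f p (stdFrame n k)) (pushforwardCLM f p (stdFrame n k)) := rfl

/-- `e_i` and `J e_i` contribute equally because `D J = -J' D`; summing over the whole frame
therefore halves the factor `1/4`. -/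
theorem dbarEnergyDensity_eq (p : EuclideanSpace ℂ (Fin n)) :
    dbarEnergyDensity g f p = (1 / 8) * ∑ k,
      g.form (f p) (dbarDefect E f p (stdFrame n k)) (dbarDefect E f p (stdFrame n k)) := by
  have h0 : dbarEnergyDensity g f p = (1 / 4) * ∑ i : Fin n,
    (g.form (f p) (pushforwardCLM f p (stdFrame n (Sum.inl i)))
        (pushforwardCLM f p (stdFrame n (Sum.inl i))) +
      g.form (f p) (pushforwardCLM f p (stdFrame n (Sum.inr i)))
        (pushforwardCLM f p (stdFrame n (Sum.inr i))) -
      2 * g.form (f p) (Complex.I • pushforwardCLM f p (stdFrame n (Sum.inl i)))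
        (pushforwardCLM f p (stdFrame n (Sum.inr i)))) := rfl
  have h1 : ∀ i : Fin n, stdFrame n (Sum.inr i) = Complex.I • stdFrame n (Sum.inl i) :=
    fun i => rfl
  have h2 : ∀ v, g.form (f p) (dbarDefect E f p (Complex.I • v))
      (dbarDefect E f p (Complex.I • v)) =
      g.form (f p) (dbarDefect E f p v) (dbarDefect E f p v) := by
    intro v
    simp only [dbarDefect_I_smul, neg_smul, map_neg, neg_apply, neg_neg, g.form_I_smul]
  have h3 : ∀ v, g.form (f p) (dbarDefect E f p v) (dbarDefect E f p v) =
      g.form (f p) (pushforwardCLM f p v) (pushforwardCLM f p v) +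
      g.form (f p) (pushforwardCLM f p (Complex.I • v)) (pushforwardCLM f p (Complex.I • v)) -
      2 * g.form (f p) (Complex.I • pushforwardCLM f p v) (pushforwardCLM f p (Complex.I • v)) := by
    intro v
    simp only [dbarDefect, map_sub, sub_apply, g.form_I_smul]
    rw [g.form_symm _ (pushforwardCLM f p (Complex.I • v)) (Complex.I • _)]
    ring
  rw [h0, Fintype.sum_sum_type]
  simp only [h1, h2, ← h3]
  ring

/-- Cauchy–Schwarz, with `|f_* e_l|² ≤ 2 e(f)` and `|D e_k|² ≤ 8 e''(f)`. -/
theorem sq_dbarStress_le (k l : Fin n ⊕ Fin n) (p : EuclideanSpace ℂ (Fin n)) :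
    dbarStress g f (stdFrame n l) (stdFrame n k) p ^ 2 ≤
      16 * (energyDensity g f p * dbarEnergyDensity g f p) := by
  have h1 := Finset.single_le_sum (f := fun k => g.form (f p) (pushforwardCLM f p (stdFrame n k))
    (pushforwardCLM f p (stdFrame n k))) (fun k _ => g.form_self_nonneg _ _) (Finset.mem_univ l)
  have h2 := Finset.single_le_sum (f := fun k => g.form (f p) (dbarDefect E f p (stdFrame n k))
    (dbarDefect E f p (stdFrame n k))) (fun k _ => g.form_self_nonneg _ _) (Finset.mem_univ k)
  rw [dbarStress_eq, energyDensity_eq, dbarEnergyDensity_eq]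
  refine (g.form_sq_le _ _ _).trans ?_
  rw [g.form_I_smul]
  refine (mul_le_mul h1 h2 (g.form_self_nonneg _ _)
    (Finset.sum_nonneg fun k _ => g.form_self_nonneg _ _)).trans (le_of_eq ?_)
  ring

variable {g f}

variable [FiniteDimensional ℂ E]

theorem contDiff_dbarStress (hf : ContMDiff 𝓘(ℝ, EuclideanSpace ℂ (Fin n)) 𝓘(ℝ, E) ∞ f)
    (v w : EuclideanSpace ℂ (Fin n)) : ContDiff ℝ ∞ (dbarStress g f v w) :=
  (contDiff_form_pushforwardCLM hf v w (Or.inl rfl)).sub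
    (contDiff_form_pushforwardCLM hf v _ (Or.inr rfl))

/-- The conservation law of the `∂̄`-energy of a harmonic map. -/
theorem IsHarmonicMap.fderiv_sum_dbarStress (hf : IsHarmonicMap g f)
    (p v : EuclideanSpace ℂ (Fin n)) :
    ∑ k, fderiv ℝ (dbarStress g f (stdFrame n k) (stdFrame n k)) p v =
      2 * ∑ k, fderiv ℝ (dbarStress g f v (stdFrame n k)) p (stdFrame n k) := by
  obtain ⟨B, hs, hneg, htr, hB⟩ := hf.exists_hessian p
  have hd : ∀ a b v, fderiv ℝ (dbarStress g f a b) p v =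
      g.form (f p) (B v a) (pushforwardCLM f p b) + g.form (f p) (pushforwardCLM f p a) (B v b) -
      (g.form (f p) (Complex.I • B v a) (pushforwardCLM f p (Complex.I • b)) +
        g.form (f p) (Complex.I • pushforwardCLM f p a) (B v (Complex.I • b))) := by
    intro a b v
    have e1 := hB 1 (Or.inl rfl) v a b
    have e2 := hB Complex.I (Or.inr rfl) v a (Complex.I • b)
    have d1 := (contDiff_form_pushforwardCLM (g := g) hf.1 a b (Or.inl rfl)).differentiable
      (by simp) p
    have d2 := (contDiff_form_pushforwardCLM (g := g) hf.1 a (Complex.I • b)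
      (Or.inr rfl)).differentiable (by simp) p
    have e3 := fderiv_fun_sub d1 d2
    rw [one_smul, one_smul] at e1
    rw [← e1, ← e2]
    exact congrArg (fun L : EuclideanSpace ℂ (Fin n) →L[ℝ] ℝ => L v) e3
  have hneg1 : ∀ v w, B (-v) w = -B v w := fun v w => by rw [hs, hneg, hs]
  -- `B` is symmetric and `J` skew, so this trace equals its own negative.
  have hBJ : ∑ k, B (stdFrame n k) (Complex.I • stdFrame n k) = 0 := by
    have h := sum_stdFrame_I_smul_left B hneg1 hneg
    simp only [hs (Complex.I • _)] at h
    have h' := eq_neg_iff_add_eq_zero.1 h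
    rw [← two_smul ℝ] at h'
    exact (smul_eq_zero.1 h').resolve_left two_ne_zero
  -- Moving `J` across shows that the two Kähler-form terms of `d(tr T)` are equal; this and the
  -- symmetry of the metric produce the factor `2`.
  have h2 := sum_stdFrame_I_smul_left
    (fun a b => g.form (f p) (Complex.I • pushforwardCLM f p a) (B v b)) (by simp)
    (fun a b => by simp [hneg])
  have h3 : ∑ k, g.form (f p) (pushforwardCLM f p v) (B (stdFrame n k) (stdFrame n k)) = 0 := by
    rw [← map_sum, htr, map_zero]
  have h4 : ∑ k, g.form (f p) (Complex.I • pushforwardCLM f p v)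
      (B (stdFrame n k) (Complex.I • stdFrame n k)) = 0 := by
    rw [← map_sum, hBJ, map_zero]
  have h5 : ∀ k, g.form (f p) (pushforwardCLM f p (stdFrame n k)) (B v (stdFrame n k)) =
      g.form (f p) (B v (stdFrame n k)) (pushforwardCLM f p (stdFrame n k)) :=
    fun k => g.form_symm _ _ _
  have h6 : ∀ k, g.form (f p) (Complex.I • pushforwardCLM f p (Complex.I • stdFrame n k))
      (B v (stdFrame n k)) =
      - g.form (f p) (Complex.I • B v (stdFrame n k))
        (pushforwardCLM f p (Complex.I • stdFrame n k)) := fun k => by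
    rw [g.form_I_smul_left, g.form_symm]
  simp only [hd, Finset.sum_add_distrib, Finset.sum_sub_distrib, h3, h4, hs _ v, h5]
  simp only [h6, Finset.sum_neg_distrib] at h2
  linarith

end Stress

/-! ### Integration against cut-off functions -/

section Integral

open MeasureTheory

theorem integral_divergence_mul {W ι : Type*} [NormedAddCommGroup W] [NormedSpace ℝ W]
    [FiniteDimensional ℝ W] [MeasurableSpace W] [BorelSpace W] (μ : Measure W)
    [μ.IsAddHaarMeasure] [Fintype ι] (e : ι → W) {φ : W → ℝ} (hφ : ContDiff ℝ 1 φ)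
    (hφc : HasCompactSupport φ) {V : ι → W → ℝ} (hV : ∀ k, ContDiff ℝ 1 (V k)) :
    ∫ x, φ x * ∑ k, fderiv ℝ (V k) x (e k) ∂μ = -∫ x, ∑ k, fderiv ℝ φ x (e k) * V k x ∂μ := by
  have hdφ : ∀ v, Continuous fun x => fderiv ℝ φ x v := fun v =>
    (hφ.continuous_fderiv (by simp)).clm_apply continuous_const
  have hdV : ∀ k v, Continuous fun x => fderiv ℝ (V k) x v := fun k v =>
    ((hV k).continuous_fderiv (by simp)).clm_apply continuous_const
  have i1 : ∀ k, Integrable (fun x => φ x * fderiv ℝ (V k) x (e k)) μ := fun k =>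
    (hφ.continuous.mul (hdV k _)).integrable_of_hasCompactSupport hφc.mul_right
  have i2 : ∀ k, Integrable (fun x => fderiv ℝ φ x (e k) * V k x) μ := fun k =>
    ((hdφ _).mul (hV k).continuous).integrable_of_hasCompactSupport
      (hφc.fderiv_apply ℝ (e k)).mul_right
  have i3 : ∀ k, Integrable (fun x => φ x * V k x) μ := fun k =>
    (hφ.continuous.mul (hV k).continuous).integrable_of_hasCompactSupport hφc.mul_right
  simp only [Finset.mul_sum]
  rw [integral_finsetSum _ fun k _ => i1 k, integral_finsetSum _ fun k _ => i2 k,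
    ← Finset.sum_neg_distrib]
  exact Finset.sum_congr rfl fun k _ => integral_mul_fderiv_eq_neg_fderiv_mul_of_integrable
    (i2 k) (i1 k) (i3 k) (fun x _ => hφ.differentiable (by simp) x)
    (fun x _ => (hV k).differentiable (by simp) x)

/-- Smooth cut-off functions at scale `R`, with derivative `O(1 / R)`. -/
theorem exists_cutoff (W : Type*) [NormedAddCommGroup W] [NormedSpace ℝ W]
    [FiniteDimensional ℝ W] :
    ∃ M > 0, ∀ R > 0, ∃ φ : W → ℝ, ContDiff ℝ 1 φ ∧ HasCompactSupport φ ∧ (∀ x, 0 ≤ φ x) ∧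
      (∀ x, φ x ≤ 1) ∧
      (∀ x, ‖x‖ ≤ R → φ x = 1) ∧ ∀ x v, |fderiv ℝ φ x v| ≤ M / R * ‖v‖ ∧
        (fderiv ℝ φ x v ≠ 0 → R ≤ ‖x‖ ∧ ‖x‖ ≤ 2 * R) := by
  let χ : ContDiffBump (0 : W) := ⟨1, 2, one_pos, one_lt_two⟩
  have hχ : ContDiff ℝ 1 χ := χ.contDiff
  obtain ⟨M, hM⟩ := (hχ.continuous_fderiv (by simp)).bounded_above_of_compact_support
    (χ.hasCompactSupport.fderiv ℝ)
  refine ⟨|M| + 1, by positivity, fun R hR => ⟨fun x => χ (R⁻¹ • x), ?_, ?_, ?_, ?_, ?_, ?_⟩⟩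
  · exact hχ.comp (contDiff_const_smul _)
  · exact χ.hasCompactSupport.comp_smul (inv_ne_zero hR.ne')
  · exact fun x => χ.nonneg
  · exact fun x => χ.le_one
  · intro x hx
    refine χ.one_of_mem_closedBall ?_
    rw [mem_closedBall_zero_iff, norm_smul, norm_inv, Real.norm_of_nonneg hR.le,
      inv_mul_le_iff₀ hR]
    simpa [χ] using hx
  · intro x v
    have hd : fderiv ℝ (fun x => χ (R⁻¹ • x)) x v = R⁻¹ * fderiv ℝ χ (R⁻¹ • x) v := by
      have h1 := ((hχ.differentiable (by simp) (R⁻¹ • x)).hasFDerivAt).comp x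
        ((hasFDerivAt_id x).const_smul R⁻¹)
      simp only [Function.comp_def] at h1
      rw [HasFDerivAt.fderiv (f := fun x => χ (R⁻¹ • x)) h1]
      simp
    have hn : ‖R⁻¹ • x‖ = ‖x‖ / R := by
      rw [norm_smul, norm_inv, Real.norm_of_nonneg hR.le, inv_mul_eq_div]
    rw [hd]
    constructor
    · rw [abs_mul, abs_inv, abs_of_pos hR, div_mul_eq_mul_div, inv_mul_eq_div]
      gcongr
      refine ((fderiv ℝ χ (R⁻¹ • x)).le_opNorm v).trans ?_
      gcongr
      linarith [hM (R⁻¹ • x), le_abs_self M]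
    · intro h
      have h0 : fderiv ℝ χ (R⁻¹ • x) ≠ 0 := fun h1 => h (by simp [h1])
      constructor
      · by_contra! hlt
        refine h0 ?_
        have : (χ : W → ℝ) =ᶠ[nhds (R⁻¹ • x)] fun _ => 1 := by
          have hmem : R⁻¹ • x ∈ Metric.ball (0 : W) 1 := by
            rw [mem_ball_zero_iff, hn, div_lt_one hR]
            exact hlt
          filter_upwards [Metric.isOpen_ball.mem_nhds hmem] with y hy
          exact χ.one_of_mem_closedBall (Metric.ball_subset_closedBall hy)
        rw [this.fderiv_eq]
        simp
      · have h1 : R⁻¹ • x ∈ tsupport χ := support_fderiv_subset ℝ h0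
        rw [χ.tsupport_eq, mem_closedBall_zero_iff, hn, div_le_iff₀ hR] at h1
        exact h1

variable {n : ℕ}

/-- A nonnegative function `τ` which is, up to the factor `2n - 2`, the divergence of a vector
field `V` of size `o(R ^ (1 - 2n))` vanishes. -/
theorem eq_zero_of_divergence (hn : 2 ≤ n)
    {V : Fin n ⊕ Fin n → EuclideanSpace ℂ (Fin n) → ℝ} (hV : ∀ k, ContDiff ℝ 1 (V k))
    {τ : EuclideanSpace ℂ (Fin n) → ℝ} (hτ : Continuous τ) (hτ0 : ∀ p, 0 ≤ τ p)
    (hdiv : ∀ p, ∑ k, fderiv ℝ (V k) p (stdFrame n k) = (2 * n - 2) * τ p)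
    {β K R₀ : ℝ} (hβ : 0 < β) (hK : 0 ≤ K) (hR₀ : 0 < R₀)
    (hbound : ∀ k p, R₀ ≤ ‖p‖ → |V k p| ≤ ‖p‖ * (K / ‖p‖ ^ (2 * n + β)))
    (p : EuclideanSpace ℂ (Fin n)) : τ p = 0 := by
  let W := EuclideanSpace ℂ (Fin n)
  let μ : Measure W := Measure.addHaar
  obtain ⟨M, hM, hcut⟩ := exists_cutoff W
  have hrank : Module.finrank ℝ W = 2 * n := by
    have := Module.finrank_mul_finrank ℝ ℂ W
    simpa [W] using this.symm
  have hnorm : ∀ k : Fin n ⊕ Fin n, ‖stdFrame n k‖ = 1 := by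
    rintro (i | i) <;> simp [stdFrame, norm_smul]
  set c := (μ (Metric.closedBall 0 1)).toReal with hc
  -- The gradient is at most `M / R`, the field at most `2R · K / R ^ (2n + β)` and the volume of
  -- the ball `(2R) ^ (2n) c`; only `R ^ (-β)` survives.
  have hint : ∀ R, R₀ ≤ R → ∀ φ : W → ℝ, ContDiff ℝ 1 φ → HasCompactSupport φ →
      (∀ x v, |fderiv ℝ φ x v| ≤ M / R * ‖v‖ ∧
        (fderiv ℝ φ x v ≠ 0 → R ≤ ‖x‖ ∧ ‖x‖ ≤ 2 * R)) →
      (2 * n - 2) * ∫ x, φ x * τ x ∂μ ≤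
        (2 * n * (M * 2 * K) * 2 ^ (2 * n) * c) / R ^ β := by
    intro R hR φ hφ hφc hdφ
    have hR0 : 0 < R := hR₀.trans_le hR
    have h1 := integral_divergence_mul μ (stdFrame n) hφ hφc hV
    simp only [hdiv] at h1
    rw [← integral_const_mul]
    have h2 : ∫ x, (2 * n - 2) * (φ x * τ x) ∂μ =
        -∫ x, ∑ k, fderiv ℝ φ x (stdFrame n k) * V k x ∂μ := by
      rw [← h1]
      congr 1
      ext x
      ring
    rw [h2]
    set D := 2 * n * (M * 2 * K) / R ^ (2 * n + β) with hD
    have hpt : ∀ k x, |fderiv ℝ φ x (stdFrame n k) * V k x| ≤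
        M * 2 * K / R ^ (2 * n + β) := by
      intro k x
      by_cases h : fderiv ℝ φ x (stdFrame n k) = 0
      · rw [h, zero_mul, abs_zero]; positivity
      · obtain ⟨ha, hb⟩ := (hdφ x _).2 h
        rw [abs_mul]
        have h3 := (hdφ x (stdFrame n k)).1
        rw [hnorm, mul_one] at h3
        -- The factor `‖x‖` is bounded by the outer radius `2R` of the annulus, the denominator by
        -- the inner radius `R`.
        have h4 : |V k x| ≤ 2 * R * (K / R ^ (2 * n + β)) := by
          refine (hbound k x (hR.trans ha)).trans ?_
          gcongr
        refine (mul_le_mul h3 h4 (abs_nonneg _) (by positivity)).trans (le_of_eq ?_)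
        field_simp
    have hzero : ∀ x, x ∉ Metric.closedBall (0 : W) (2 * R) →
        ∑ k, fderiv ℝ φ x (stdFrame n k) * V k x = 0 := by
      intro x hx
      refine Finset.sum_eq_zero fun k _ => ?_
      by_cases h : fderiv ℝ φ x (stdFrame n k) = 0
      · rw [h, zero_mul]
      · exact absurd (mem_closedBall_zero_iff.2 ((hdφ x _).2 h).2) hx
    have hle : ‖∫ x in Metric.closedBall (0 : W) (2 * R),
        ∑ k, fderiv ℝ φ x (stdFrame n k) * V k x ∂μ‖ ≤
        D * μ.real (Metric.closedBall (0 : W) (2 * R)) := by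
      refine norm_setIntegral_le_of_norm_le_const
        (isCompact_closedBall _ _).measure_lt_top fun x _ => ?_
      refine (Finset.abs_sum_le_sum_abs _ _).trans
        ((Finset.sum_le_sum fun k _ => hpt k x).trans (le_of_eq ?_))
      simp [hD]
      ring
    rw [setIntegral_eq_integral_of_forall_compl_eq_zero hzero, Real.norm_eq_abs] at hle
    refine (neg_le_abs _).trans (hle.trans (le_of_eq ?_))
    rw [Measure.real, Measure.addHaar_closedBall' μ _ (by positivity), ENNReal.toReal_mul,
      ENNReal.toReal_ofReal (by positivity), hrank, ← hc, hD, Real.rpow_add hR0]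
    have : (R : ℝ) ^ (2 * (n : ℝ)) = R ^ (2 * n) := by
      rw [← Real.rpow_natCast]; push_cast; rfl
    rw [this, mul_pow]
    field_simp
  by_contra hp
  -- A fixed cut-off around `p` gives a positive integral. Cut-offs `ψ` at large scales dominate it,
  -- so their integrals cannot tend to `0`.
  obtain ⟨φ, hφ, hφc, hφ0, hφ1, hφp, -⟩ := hcut (‖p‖ + 1) (by positivity)
  have hcont : Continuous fun x => φ x * τ x := hφ.continuous.mul hτ
  have hpos : 0 < ∫ x, φ x * τ x ∂μ := by
    refine hcont.integral_pos_of_hasCompactSupport_nonneg_nonzero (x := p) hφc.mul_right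
      (fun x => mul_nonneg (hφ0 x) (hτ0 x)) ?_
    rw [hφp p (by linarith), one_mul]
    exact hp
  obtain ⟨r, hr⟩ := hφc.isCompact.isBounded.subset_closedBall (0 : W)
  have hlim : Filter.Tendsto (fun R : ℝ => (2 * n * (M * 2 * K) * 2 ^ (2 * n) * c) / R ^ β)
      Filter.atTop (nhds 0) := (tendsto_rpow_atTop hβ).const_div_atTop _
  have hn2 : (0 : ℝ) < 2 * n - 2 := by
    have : (2 : ℝ) ≤ n := by exact_mod_cast hn
    linarith
  obtain ⟨R, hRlt, hR⟩ := ((hlim.eventually_lt_const (mul_pos hn2 hpos)).and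
    (Filter.eventually_ge_atTop (max R₀ r))).exists
  have hR1 := (le_max_left _ _).trans hR
  obtain ⟨ψ, hψ, hψc, hψ0, -, hψ1, hψd⟩ := hcut R (hR₀.trans_le hR1)
  refine absurd (hint R hR1 ψ hψ hψc hψd) (not_le.2 (hRlt.trans_le ?_))
  refine mul_le_mul_of_nonneg_left ?_ hn2.le
  have i1 : Integrable (fun x => φ x * τ x) μ :=
    hcont.integrable_of_hasCompactSupport hφc.mul_right
  have i2 : Integrable (fun x => ψ x * τ x) μ :=
    (hψ.continuous.mul hτ).integrable_of_hasCompactSupport hψc.mul_right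
  refine integral_mono i1 i2 fun x => ?_
  refine mul_le_mul_of_nonneg_right ?_ (hτ0 x)
  by_cases hx : φ x = 0
  · rw [hx]
    exact hψ0 x
  · have h1 := mem_closedBall_zero_iff.1 (hr (subset_tsupport φ hx))
    rw [hψ1 x (h1.trans ((le_max_right _ _).trans hR))]
    exact hφ1 x

end Integral

/-! ### Contraction with the position vector -/

section Field

variable {E : Type*} [NormedAddCommGroup E] [NormedSpace ℂ E]
  {N : Type*} [TopologicalSpace N] [ChartedSpace E N] [IsManifold 𝓘(ℂ, E) ω N] {n : ℕ}

/-- The components of the vector field obtained by contracting the conserved tensor of the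
`∂̄`-energy with the position vector. -/
def dbarField (g : KahlerMetric E N) (f : EuclideanSpace ℂ (Fin n) → N) (k : Fin n ⊕ Fin n)
    (p : EuclideanSpace ℂ (Fin n)) : ℝ :=
  stdCoord n k p * (2 * ∑ j, dbarStress g f (stdFrame n j) (stdFrame n j) p) -
    4 * ∑ l, stdCoord n l p * dbarStress g f (stdFrame n l) (stdFrame n k) p

variable {g : KahlerMetric E N} {f : EuclideanSpace ℂ (Fin n) → N}

/-- The constant is `12n = 2 · 2n + 4 · 2n`, each sum having `2n` terms. -/
theorem abs_dbarField_le {B : ℝ} {p : EuclideanSpace ℂ (Fin n)}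
    (h : ∀ k l, |dbarStress g f (stdFrame n l) (stdFrame n k) p| ≤ B) (k : Fin n ⊕ Fin n) :
    |dbarField g f k p| ≤ ‖p‖ * (12 * n * B) := by
  have h1 : |∑ j, dbarStress g f (stdFrame n j) (stdFrame n j) p| ≤ 2 * n * B := by
    refine (Finset.abs_sum_le_sum_abs _ _).trans
      ((Finset.sum_le_sum fun j _ => h j j).trans (le_of_eq ?_))
    simp [-mul_eq_mul_right_iff]
    ring
  have h2 : |∑ l, stdCoord n l p * dbarStress g f (stdFrame n l) (stdFrame n k) p| ≤
      2 * n * (‖p‖ * B) := by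
    refine (Finset.abs_sum_le_sum_abs _ _).trans
      ((Finset.sum_le_sum (g := fun _ => ‖p‖ * B) fun l _ => ?_).trans (le_of_eq ?_))
    · rw [abs_mul]
      exact mul_le_mul (abs_stdCoord_le l p) (h k l) (abs_nonneg _) (norm_nonneg _)
    · simp [-mul_eq_mul_right_iff]
      ring
  have h3 := mul_le_mul (abs_stdCoord_le k p) h1 (abs_nonneg _) (norm_nonneg _)
  rw [← abs_mul] at h3
  rw [dbarField]
  rw [abs_le] at h2 h3 ⊢
  constructor <;> linarith [h2.1, h2.2, h3.1, h3.2]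

variable [FiniteDimensional ℂ E]

theorem contDiff_dbarField (hf : ContMDiff 𝓘(ℝ, EuclideanSpace ℂ (Fin n)) 𝓘(ℝ, E) ∞ f)
    (k : Fin n ⊕ Fin n) : ContDiff ℝ ∞ (dbarField g f k) :=
  ((stdCoord n k).contDiff.mul (contDiff_const.mul
    (ContDiff.sum fun _ _ => contDiff_dbarStress hf _ _))).sub
      (contDiff_const.mul (ContDiff.sum fun l _ => (stdCoord n l).contDiff.mul
        (contDiff_dbarStress hf _ _)))

/-- Differentiating the coordinates gives `2n · 2 tr T - 4 tr T`; by the conservation law the terms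
that differentiate `T` cancel. -/
theorem IsHarmonicMap.divergence_dbarField (hf : IsHarmonicMap g f)
    (p : EuclideanSpace ℂ (Fin n)) :
    ∑ k, fderiv ℝ (dbarField g f k) p (stdFrame n k) =
      (2 * n - 2) * (2 * ∑ j, dbarStress g f (stdFrame n j) (stdFrame n j) p) := by
  have hd : ∀ v w, HasFDerivAt (dbarStress g f v w) (fderiv ℝ (dbarStress g f v w) p) p :=
    fun v w => ((contDiff_dbarStress hf.1 v w).differentiable (by simp) p).hasFDerivAt
  have hk : ∀ k, fderiv ℝ (dbarField g f k) p (stdFrame n k) =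
      2 * ∑ j, dbarStress g f (stdFrame n j) (stdFrame n j) p +
      4 * (∑ l, stdCoord n k p *
        fderiv ℝ (dbarStress g f (stdFrame n k) (stdFrame n l)) p (stdFrame n l)) -
      4 * (dbarStress g f (stdFrame n k) (stdFrame n k) p) -
      4 * ∑ l, stdCoord n l p *
        fderiv ℝ (dbarStress g f (stdFrame n l) (stdFrame n k)) p (stdFrame n k) := by
    intro k
    have h1 := (HasFDerivAt.fun_sum (u := Finset.univ)
      fun j _ => hd (stdFrame n j) (stdFrame n j)).const_mul 2
    have h2 := (HasFDerivAt.fun_sum (u := Finset.univ)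
      fun l _ => (stdCoord n l).hasFDerivAt.mul (hd (stdFrame n l) (stdFrame n k))).const_mul 4
    have h3 : HasFDerivAt (dbarField g f k) _ p := ((stdCoord n k).hasFDerivAt.mul h1).sub h2
    have h4 := hf.fderiv_sum_dbarStress p (stdFrame n k)
    rw [h3.fderiv]
    simp only [add_apply, sub_apply, smul_apply, sum_apply, smul_eq_mul, h4, stdCoord_stdFrame,
      Finset.sum_add_distrib, mul_ite, mul_one, mul_zero, if_true, Finset.sum_ite_eq',
      Finset.mem_univ, ← Finset.mul_sum]
    ring
  simp only [hk, Finset.sum_add_distrib, Finset.sum_sub_distrib, ← Finset.mul_sum]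
  -- The remaining double sums differ only by exchanging `k` and `l`.
  have hcomm := Finset.sum_comm (s := Finset.univ) (t := Finset.univ)
    (f := fun k l => stdCoord n k p *
      fderiv ℝ (dbarStress g f (stdFrame n k) (stdFrame n l)) p (stdFrame n l))
  simp only [← Finset.mul_sum] at hcomm
  rw [← hcomm]
  simp [-mul_eq_mul_right_iff, -Fintype.sum_sum_type]
  ring

end Field
end

/-! ### Conclusion -/

theorem theorem1p1 {n : ℕ} (hn : 2 ≤ n)
    {E : Type*} [NormedAddCommGroup E] [NormedSpace ℂ E] [FiniteDimensional ℂ E]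
    {N : Type*} [TopologicalSpace N] [ChartedSpace E N] [IsManifold 𝓘(ℂ, E) ω N]
    (g : KahlerMetric E N) (f : EuclideanSpace ℂ (Fin n) → N) (hf : IsHarmonicMap g f)
    {α : ℝ} (hα : 0 < α)
    (hdecay : ∃ C > 0, ∃ R₀ > 0, ∀ p : EuclideanSpace ℂ (Fin n), R₀ ≤ ‖p‖ →
      energyDensity g f p * dbarEnergyDensity g f p ≤ C / ‖p‖ ^ (4 * (n : ℝ) + α)) :
    IsHolomorphicMap E f := by
  obtain ⟨C, hC, R₀, hR₀, hdecay⟩ := hdecay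
  -- The square root halves the exponent `4n + α`, so the divergence argument applies with `β = α /
  -- 2`.
  have hstress : ∀ p : EuclideanSpace ℂ (Fin n), R₀ ≤ ‖p‖ → ∀ k l,
      |dbarStress g f (stdFrame n l) (stdFrame n k) p| ≤
        4 * √C / ‖p‖ ^ (2 * (n : ℝ) + α / 2) := by
    intro p hp k l
    have hp0 : 0 < ‖p‖ := hR₀.trans_le hp
    refine abs_le_of_sq_le_sq ?_ (by positivity)
    refine (sq_dbarStress_le g f k l p).trans
      ((mul_le_mul_of_nonneg_left (hdecay p hp) (by norm_num)).trans (le_of_eq ?_))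
    rw [div_pow, mul_pow, Real.sq_sqrt hC.le, ← Real.rpow_mul_natCast hp0.le]
    ring_nf
  have hsum := sum_form_dbarDefect g f
  have hzero := eq_zero_of_divergence (K := 12 * n * (4 * √C)) hn
    (fun k => (contDiff_dbarField (g := g) hf.1 k).of_le (by simp))
    (continuous_const.mul (continuous_finsetSum _ fun j _ =>
      (contDiff_dbarStress hf.1 (stdFrame n j) (stdFrame n j)).continuous))
    (fun p => (Finset.sum_nonneg fun k _ => g.form_self_nonneg _ _).trans_eq (hsum p))
    hf.divergence_dbarField (half_pos hα) (by positivity) hR₀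
    (fun k p hp => (abs_dbarField_le (hstress p hp) k).trans (le_of_eq (by ring)))
  refine isHolomorphicMap_of_dbarDefect hf.1 fun p k => ?_
  have h := (hsum p).trans (hzero p)
  rw [Finset.sum_eq_zero_iff_of_nonneg fun k _ => g.form_self_nonneg _ _] at h
  by_contra hk
  exact (g.form_self_pos (f p) hk).ne' (h k (Finset.mem_univ k))
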